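/- Let $P\subset\mathbb{R}^2$ be a polyomino, i.e. the union of finitely many (at least one) closed unit squares with integer vertices (pixels) that are connected through common edges; holes are allowed. A point $q\in P$ is seen from a point $p\in P$ if the segment $pq$ is contained in $P$ and $\|p-q\|_\infty\le 1$. A finite set $\mathcal S\subset P$ of scan points covers $P$ if every point of $P$ is seen from some point of $\mathcal S$. A solution of the milling variant of the Myopic Watchman Problem with Discrete Vision (MWPDV) is a pair $(T,\mathcal S)$ of a closed continuous tour $T$ in $P$ and a finite set $\mathcal S$ of points on $T$ that covers $P$. A milling tour of $P$ is a closed continuous tour in $P$ such that the axis-parallel $2\times 2$ square whose center follows the tour always stays in $P$ and sweeps all of $P$. Let tour length $L$ be measured either in the Euclidean or in the $L_1$ metric. Then for either choice there is an MWPDV milling solution $(T,\mathcal S)$ such that 1. $|\mathcal S|\le 2.5\,|\mathcal S'|$ for every finite set $\mathcal S'\subset P$ that covers $P$, i.e. the solution uses at most $2.5$ times the minimum number of scans; and 2. $L(T)\le 2.5\,L(T')$ both for the tour $T'$ of every MWPDV milling solution $(T',\mathcal S')$ and for every milling tour $T'$ of $P$, i.e. the tour length is at most $2.5$ times that of an optimal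 milling tour, with discrete or with continuous vision. -/

import Mathlib

open Set
open scoped ENNReal

/-- The closed unit square (pixel) of the plane with lower left corner `c`.

Points of the plane are elements of `ℝ × ℝ`; the metric that Mathlib puts on this type is the
`L∞` metric, which is the one in which the scan range is measured. -/
def pixel (c : ℤ × ℤ) : Set (ℝ × ℝ) :=
  Icc (c.1 : ℝ) (c.1 + 1) ×ˢ Icc (c.2 : ℝ) (c.2 + 1)

/-- Two pixels are adjacent if they share an edge. -/
def PixelAdj (a b : ℤ × ℤ) : Prop :=
  |a.1 - b.1| + |a.2 - b.2| = 1

/-- A polyomino, given by its pixels: finitely many (at least one) pixels that are connected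
through common edges. Holes are allowed. -/
structure IsPolyomino (C : Finset (ℤ × ℤ)) : Prop where
  nonempty : C.Nonempty
  connected : ∀ a ∈ C, ∀ b ∈ C,
    Relation.ReflTransGen (fun x y => x ∈ C ∧ y ∈ C ∧ PixelAdj x y) a b

/-- The region of the plane that is occupied by the pixels in `C`. -/
def region (C : Finset (ℤ × ℤ)) : Set (ℝ × ℝ) :=
  ⋃ c ∈ C, pixel c

/-- `q` is seen by a scan at `p`: the segment `pq` stays in `P`, and `q` has `L∞` distance at
most `1` from `p`. -/
def Sees (P : Set (ℝ × ℝ)) (p q : ℝ × ℝ) : Prop :=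
  segment ℝ p q ⊆ P ∧ dist p q ≤ 1

/-- `S` is a set of scan points in `P` that covers `P`. -/
structure IsScanCover (P : Set (ℝ × ℝ)) (S : Finset (ℝ × ℝ)) : Prop where
  subset : ∀ p ∈ S, p ∈ P
  covers : ∀ q ∈ P, ∃ p ∈ S, Sees P p q

/-- `γ`, restricted to `[0, 1]`, is a closed continuous curve in `P`. -/
structure IsClosedTour (P : Set (ℝ × ℝ)) (γ : ℝ → ℝ × ℝ) : Prop where
  continuousOn : ContinuousOn γ (Icc 0 1)
  closed : γ 0 = γ 1
  mem : ∀ t ∈ Icc (0 : ℝ) 1, γ t ∈ P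

/-- The length of the tour `γ` in the metric `L_p` of the plane (possibly infinite). -/
noncomputable def tourLength (p : ℝ≥0∞) [Fact (1 ≤ p)] (γ : ℝ → ℝ × ℝ) : ℝ≥0∞ :=
  eVariationOn (fun t => WithLp.toLp p (γ t)) (Icc 0 1)

/-- A solution of the milling variant of the Myopic Watchman Problem with Discrete Vision, for
`L∞` scan range `1`: a closed tour in `P` and finitely many scan points on the tour that
cover `P`. -/
structure IsMWPDVSolution (P : Set (ℝ × ℝ)) (γ : ℝ → ℝ × ℝ) (S : Finset (ℝ × ℝ)) : Prop where
  tour : IsClosedTour P γ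
  on_tour : ∀ p ∈ S, ∃ t ∈ Icc (0 : ℝ) 1, γ t = p
  cover : IsScanCover P S

/-- A (continuous) milling tour of `P` for the `2 × 2` square cutter, the `L∞` ball of radius
`1`: when the centre of the cutter follows the tour, the cutter stays in `P` at all times and
sweeps all of `P`. -/
structure IsMillingTour (P : Set (ℝ × ℝ)) (γ : ℝ → ℝ × ℝ) : Prop where
  tour : IsClosedTour P γ
  cutter_subset : ∀ t ∈ Icc (0 : ℝ) 1, Metric.closedBall (γ t) 1 ⊆ P
  sweeps : ∀ q ∈ P, ∃ t ∈ Icc (0 : ℝ) 1, q ∈ Metric.closedBall (γ t) 1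

/-!
Write `P` for the region. A scan at a grid vertex sees the whole of every pixel that has the vertex
as a corner, so a set of vertices on a tour is a scan cover as soon as it *hits* all pixels, i.e.
contains a corner of each pixel. Let `σ` be the least number of vertices that hit all pixels, and
`n` the least `L₁` length of a closed walk through grid vertices that hits all pixels, where a step
joins two corners of a pixel.

*Lower bounds.* For an offset `o` in the open unit square, round a point `p` to the vertex
`roundPt o p`, coordinate by coordinate, by `x ↦ ⌊x - oᵢ⌋ + 1`. This is a corner of any pixel
containing `p`, and a corner of the pixel `c` if `p` has `L∞` distance less than `1` from `c + o`. For
almost every offset, "distance at most `1`" can be replaced by "distance less than `1`", as spheres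
around compact sets are null (`volume_infDist_eq_one`). Hence rounding turns a scan cover into a set
of vertices that hits all pixels, and it has at least `σ` elements (`IsScanCover.exists_hitsAll`).
It also turns a tour that comes within distance `1` of each point of `P` into a closed grid walk
that hits all pixels; averaged over the offset, its length is at most the `L₁` length of the tour,
which is therefore at least `n` (`IsClosedTour.le_tourLength_one`). Both the tours of MWPDV
solutions and milling tours are of this kind.

*Upper bound* (`exists_bicriteria_gridWalk`). Take a closed walk of length `n` that hits all pixels,
and let `V` be the set of its vertices. If `|V| ≤ 5/2 σ`, scan at all of `V`. Otherwise
`σ < 2/5 |V| ≤ 2/5 n`. Take a minimum set `S₀` of vertices that hits all pixels; `σ ≥ 2`, as one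
vertex would be a walk of length `0`. Visit `⌈σ/2⌉ ≤ 2/3 σ` vertices of `S₀` by detours, each from a
vertex of the walk across one pixel and back, and scan there; for each other vertex of `S₀` scan at
four vertices of `V` instead, one for each of its pixels. These are at most `5/2 σ` scans, and the
detours have total length at most `2κ · 2/3 · 2/5 · n = 8/15 κ n`, where the diameter `κ` of a pixel
is `2` in the `L₁` and `√2` in the Euclidean metric. As the `L₁` length of a tour is at most `√2`
times its Euclidean length, the claim comes down to `1 + 16/15 ≤ 5/2` and `√2 + 16/15 ≤ 5/2`.
-/

/-! ### Grid vertices and walks -/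

/-- The grid vertex `v` is one of the four corners of the pixel with lower left corner `c`. -/
def IsPixelCorner (v c : ℤ × ℤ) : Prop :=
  (v.1 = c.1 ∨ v.1 = c.1 + 1) ∧ (v.2 = c.2 ∨ v.2 = c.2 + 1)

/-- A grid vertex as a point of the plane. -/
def gridPt (v : ℤ × ℤ) : ℝ × ℝ := (v.1, v.2)

/-- The `L₁` distance of two grid vertices. -/
def gridDist (u v : ℤ × ℤ) : ℕ := (u.1 - v.1).natAbs + (u.2 - v.2).natAbs

/-- Every pixel of `C` has a corner in `V`. -/
def HitsAll (C V : Finset (ℤ × ℤ)) : Prop := ∀ c ∈ C, ∃ v ∈ V, IsPixelCorner v c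

/-- `GridWalk C d u v V ℓ`: there is a walk from `u` to `v` through grid vertices, any two
consecutive ones being corners of a common pixel of `C`, such that `V` is the set of visited
vertices and `ℓ` is the sum of the costs `d` of the steps. -/
inductive GridWalk {M : Type*} [AddCommMonoid M] (C : Finset (ℤ × ℤ))
    (d : ℤ × ℤ → ℤ × ℤ → M) : ℤ × ℤ → ℤ × ℤ → Finset (ℤ × ℤ) → M → Prop
  | single {u c : ℤ × ℤ} (hc : c ∈ C) (hu : IsPixelCorner u c) : GridWalk C d u u {u} 0
  | step {u v w c : ℤ × ℤ} {V : Finset (ℤ × ℤ)} {ℓ : M} (h : GridWalk C d u v V ℓ) (hc : c ∈ C)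
      (hv : IsPixelCorner v c) (hw : IsPixelCorner w c) : GridWalk C d u w (insert w V) (ℓ + d v w)

namespace GridWalk

variable {M : Type*} [AddCommMonoid M] {C V V' : Finset (ℤ × ℤ)} {d : ℤ × ℤ → ℤ × ℤ → M}
  {u v w s c : ℤ × ℤ} {ℓ ℓ' : M}

lemma left_mem (h : GridWalk C d u v V ℓ) : u ∈ V := by
  induction h with
  | single => simp
  | step _ _ _ _ ih => exact Finset.mem_insert_of_mem ih

lemma right_mem (h : GridWalk C d u v V ℓ) : v ∈ V := by
  cases h <;> simp

lemma exists_isPixelCorner (h : GridWalk C d u v V ℓ) : ∀ x ∈ V, ∃ c ∈ C, IsPixelCorner x c := by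
  induction h with
  | single hc hu => intro x hx; rw [Finset.mem_singleton.1 hx]; exact ⟨_, hc, hu⟩
  | step _ hc _ hw ih =>
    intro x hx
    rcases Finset.mem_insert.1 hx with rfl | hx
    · exact ⟨_, hc, hw⟩
    · exact ih x hx

lemma append (h : GridWalk C d u v V ℓ) (h' : GridWalk C d v w V' ℓ') :
    GridWalk C d u w (V ∪ V') (ℓ + ℓ') := by
  induction h' with
  | single =>
    have : V ∪ {v} = V := by simpa using h.right_mem
    rwa [this, add_zero]
  | step _ hc hv hw ih =>
    rw [Finset.union_insert, ← add_assoc]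
    exact ih.step hc hv hw

/-- From a visited vertex `w`, a walk can make a detour across a pixel to `s` and back. -/
lemma detour (h : GridWalk C d u v V ℓ) (hw : w ∈ V) (hc : c ∈ C) (hwc : IsPixelCorner w c)
    (hs : IsPixelCorner s c) : GridWalk C d u v (insert s V) (ℓ + (d w s + d s w)) := by
  induction h with
  | single hc' hu =>
    rw [Finset.mem_singleton] at hw
    subst hw
    have := ((GridWalk.single (d := d) hc' hu).step hc hwc hs).step hc hs hwc
    rw [add_assoc] at this
    convert this using 1
    ext x
    simp only [Finset.mem_insert, Finset.mem_singleton]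
    tauto
  | @step v' x c' V ℓ h hc' hv hx ih =>
    rcases Finset.mem_insert.1 hw with rfl | hw
    · have := ((h.step hc' hv hx).step hc hwc hs).step hc hs hwc
      rw [add_assoc _ (d w s)] at this
      convert this using 1
      ext y
      simp only [Finset.mem_insert]
      tauto
    · have := (ih hw).step hc' hv hx
      rw [Finset.insert_comm, add_right_comm]
      exact this

/-- A walk that hits all pixels can visit further vertices by detours across one pixel each. -/
lemma exists_detours {κ : ℝ≥0∞} {d : ℤ × ℤ → ℤ × ℤ → ℝ≥0∞} {ℓ : ℝ≥0∞}
    (hd : ∀ c v w, IsPixelCorner v c → IsPixelCorner w c → d v w ≤ κ)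
    (h : GridWalk C d u v V ℓ) (hV : HitsAll C V) (D : Finset (ℤ × ℤ))
    (hD : ∀ s ∈ D, ∃ c ∈ C, IsPixelCorner s c) :
    ∃ V' ℓ', V ⊆ V' ∧ D ⊆ V' ∧ ℓ' ≤ ℓ + D.card * (2 * κ) ∧ GridWalk C d u v V' ℓ' := by
  induction D using Finset.induction_on with
  | empty => exact ⟨V, ℓ, subset_rfl, by simp, by simp, h⟩
  | insert s D hs ih =>
    obtain ⟨V', ℓ', h1, h2, h3, h4⟩ := ih fun x hx => hD x (Finset.mem_insert_of_mem hx)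
    obtain ⟨c, hc, hsc⟩ := hD s (Finset.mem_insert_self _ _)
    obtain ⟨w, hw, hwc⟩ := hV c hc
    refine ⟨insert s V', ℓ' + (d w s + d s w), h1.trans (Finset.subset_insert _ _),
      Finset.insert_subset_insert _ h2, ?_, h4.detour (h1 hw) hc hwc hsc⟩
    rw [Finset.card_insert_of_notMem hs]
    calc ℓ' + (d w s + d s w) ≤ (ℓ + D.card * (2 * κ)) + (κ + κ) :=
          add_le_add h3 (add_le_add (hd c _ _ hwc hsc) (hd c _ _ hsc hwc))
      _ = ℓ + (D.card + 1 : ℕ) * (2 * κ) := by push_cast; ring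

/-- The same walk for a cheaper cost. -/
lemma exists_le {d : ℤ × ℤ → ℤ × ℤ → ℝ≥0∞} (hd : ∀ v w, d v w ≤ gridDist v w) {n : ℕ}
    (h : GridWalk C gridDist u v V n) : ∃ ℓ ≤ (n : ℝ≥0∞), GridWalk C d u v V ℓ := by
  induction h with
  | single hc hu => exact ⟨0, by simp, .single hc hu⟩
  | step _ hc hv hw ih =>
    obtain ⟨ℓ, h1, h2⟩ := ih
    refine ⟨_, ?_, h2.step hc hv hw⟩
    push_cast
    gcongr
    exact hd _ _

/-- A walk of length `n` visits at most `n + 1` vertices, and at most `n` if it is closed and not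
constant. -/
lemma card_le {n : ℕ} (h : GridWalk C gridDist u v V n) :
    V.card ≤ n + 1 ∧ (u = v → V.card ≤ max 1 n) := by
  induction h with
  | single => simp
  | @step v w c V n h hc hv hw ih =>
    by_cases hvw : v = w
    · subst hvw
      rw [Finset.insert_eq_of_mem h.right_mem]
      simpa [gridDist] using ih
    · have h1 : 1 ≤ gridDist v w := by
        by_contra! h0
        apply hvw
        ext <;> simp only [gridDist] at h0 <;> omega
      by_cases hwV : w ∈ V
      · rw [Finset.insert_eq_of_mem hwV]
        omega
      · rw [Finset.card_insert_of_notMem hwV]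
        refine ⟨by omega, fun huw => ?_⟩
        exact absurd (huw ▸ h.left_mem) hwV

end GridWalk

lemma isPixelCorner_self (c : ℤ × ℤ) : IsPixelCorner c c := by simp [IsPixelCorner]

/-- The lower left corners of two adjacent pixels are corners of one of them. -/
lemma PixelAdj.exists_isPixelCorner {a b : ℤ × ℤ} (h : PixelAdj a b) :
    ∃ c, (c = a ∨ c = b) ∧ IsPixelCorner a c ∧ IsPixelCorner b c := by
  unfold PixelAdj at h
  have h1 := abs_cases (a.1 - b.1)
  have h2 := abs_cases (a.2 - b.2)
  by_cases hab : a.1 ≤ b.1 ∧ a.2 ≤ b.2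
  · refine ⟨a, .inl rfl, isPixelCorner_self a, ?_⟩
    simp only [IsPixelCorner]; omega
  · refine ⟨b, .inr rfl, ?_, isPixelCorner_self b⟩
    simp only [IsPixelCorner]; omega

lemma IsPolyomino.exists_gridWalk {C : Finset (ℤ × ℤ)} (hC : IsPolyomino C) {a b : ℤ × ℤ}
    (ha : a ∈ C) (hb : b ∈ C) : ∃ V n, GridWalk C gridDist a b V n := by
  have h := hC.connected a ha b hb
  clear hb
  induction h with
  | refl => exact ⟨_, _, .single ha (isPixelCorner_self a)⟩
  | tail _ h ih =>
    obtain ⟨V, n, hV⟩ := ih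
    obtain ⟨c, hc, h1, h2⟩ := h.2.2.exists_isPixelCorner
    have hcC : c ∈ C := by
      rcases hc with rfl | rfl
      · exact h.1
      · exact h.2.1
    exact ⟨_, _, hV.step hcC h1 h2⟩

lemma IsPolyomino.exists_closed_gridWalk {C : Finset (ℤ × ℤ)} (hC : IsPolyomino C) :
    ∃ n u V, GridWalk C gridDist u u V n ∧ HitsAll C V := by
  obtain ⟨a, ha⟩ := hC.nonempty
  have key : ∀ A : Finset (ℤ × ℤ), A ⊆ C → ∃ V n, GridWalk C gridDist a a V n ∧ A ⊆ V := by
    intro A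
    induction A using Finset.induction_on with
    | empty => intro _; exact ⟨_, _, .single ha (isPixelCorner_self a), by simp⟩
    | insert b A _ ih =>
      intro hA
      rw [Finset.insert_subset_iff] at hA
      obtain ⟨V, n, h, hV⟩ := ih hA.2
      obtain ⟨V₁, n₁, h₁⟩ := hC.exists_gridWalk ha hA.1
      obtain ⟨V₂, n₂, h₂⟩ := hC.exists_gridWalk hA.1 ha
      refine ⟨_, _, h.append (h₁.append h₂), ?_⟩
      rw [Finset.insert_subset_iff]
      refine ⟨?_, hV.trans Finset.subset_union_left⟩
      simp [h₁.right_mem]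
  obtain ⟨V, n, h, hV⟩ := key C subset_rfl
  exact ⟨n, a, V, h, fun c hc => ⟨c, hV hc, isPixelCorner_self c⟩⟩

/-! ### Polygonal tours -/

lemma mem_pixel {q : ℝ × ℝ} {c : ℤ × ℤ} :
    q ∈ pixel c ↔ ((c.1 : ℝ) ≤ q.1 ∧ q.1 ≤ c.1 + 1) ∧ ((c.2 : ℝ) ≤ q.2 ∧ q.2 ≤ c.2 + 1) := by
  simp only [pixel, mem_prod, mem_Icc]

lemma mem_region {C : Finset (ℤ × ℤ)} {q : ℝ × ℝ} : q ∈ region C ↔ ∃ c ∈ C, q ∈ pixel c := by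
  simp [region]

lemma convex_pixel (c : ℤ × ℤ) : Convex ℝ (pixel c) :=
  (convex_Icc _ _).prod (convex_Icc _ _)

lemma IsPixelCorner.gridPt_mem {v c : ℤ × ℤ} (h : IsPixelCorner v c) : gridPt v ∈ pixel c := by
  obtain ⟨h1 | h1, h2 | h2⟩ := h <;> simp [mem_pixel, gridPt, h1, h2]

/-- A walk is traced by a polygonal curve, of the same length. -/
lemma GridWalk.exists_curve {C V : Finset (ℤ × ℤ)} {u v : ℤ × ℤ} {p ℓ : ℝ≥0∞} [Fact (1 ≤ p)]
    (h : GridWalk C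
      (fun v w => edist (WithLp.toLp p (gridPt v)) (WithLp.toLp p (gridPt w))) u v V ℓ) :
    ∃ (T : ℝ) (γ : ℝ → ℝ × ℝ), 0 < T ∧ ContinuousOn γ (Icc 0 T) ∧ γ 0 = gridPt u ∧
      γ T = gridPt v ∧ (∀ t ∈ Icc 0 T, γ t ∈ region C) ∧
      (∀ x ∈ V, ∃ t ∈ Icc 0 T, γ t = gridPt x) ∧
      eVariationOn (fun t => WithLp.toLp p (γ t)) (Icc 0 T) ≤ ℓ := by
  induction h with
  | @single c hc hu =>
    refine ⟨1, fun _ => gridPt u, one_pos, continuousOn_const, rfl, rfl,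
      fun t _ => mem_region.2 ⟨c, hc, hu.gridPt_mem⟩, fun x hx => ⟨0, by simp, ?_⟩, ?_⟩
    · rw [Finset.mem_singleton.1 hx]
    · exact (eVariationOn.constant_on (by
        rintro _ ⟨_, _, rfl⟩ _ ⟨_, _, rfl⟩; rfl)).le
  | @step v w c V ℓ h hc hv hw ih =>
    obtain ⟨T, γ, hT, hcont, h0, h1, hmem, hvis, hlen⟩ := ih
    set σ : ℝ → ℝ × ℝ := fun t => AffineMap.lineMap (gridPt v) (gridPt w) (t - T) with hσ
    set γ' : ℝ → ℝ × ℝ := fun t => if t ≤ T then γ t else σ t with hγ'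
    have e1 : EqOn γ' γ (Icc 0 T) := fun t ht => by simp [hγ', ht.2]
    have hσT : σ T = gridPt v := by simp [hσ]
    have e2 : EqOn γ' σ (Icc T (T + 1)) := fun t ht => by
      by_cases htT : t ≤ T
      · obtain rfl : t = T := le_antisymm htT ht.1
        simp [hγ', hσT, h1]
      · simp [hγ', htT]
    have hun : Icc 0 T ∪ Icc T (T + 1) = Icc 0 (T + 1) :=
      Icc_union_Icc_eq_Icc hT.le (by linarith)
    refine ⟨T + 1, γ', by linarith, ?_, ?_, ?_, ?_, ?_, ?_⟩
    · rw [← hun]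
      refine (hcont.congr e1).union_of_isClosed ?_ isClosed_Icc isClosed_Icc
      refine ContinuousOn.congr (Continuous.continuousOn ?_) e2
      exact AffineMap.lineMap_continuous.comp (continuous_id.sub continuous_const)
    · rw [e1 ⟨le_rfl, hT.le⟩, h0]
    · rw [e2 ⟨by linarith, le_rfl⟩]; simp [hσ]
    · rw [← hun]
      rintro t (ht | ht)
      · rw [e1 ht]; exact hmem t ht
      · rw [e2 ht]
        refine mem_region.2 ⟨c, hc, ?_⟩
        exact (convex_pixel c).lineMap_mem hv.gridPt_mem hw.gridPt_mem
          ⟨by linarith [ht.1], by linarith [ht.2]⟩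
    · intro x hx
      rcases Finset.mem_insert.1 hx with rfl | hx
      · refine ⟨T + 1, ⟨by linarith, le_rfl⟩, ?_⟩
        rw [e2 ⟨by linarith, le_rfl⟩]; simp [hσ]
      · obtain ⟨t, ht, htx⟩ := hvis x hx
        exact ⟨t, ⟨ht.1, by linarith [ht.2]⟩, by rw [e1 ht, htx]⟩
    · have hsplit := eVariationOn.Icc_add_Icc (fun t => WithLp.toLp p (γ' t)) (s := univ) hT.le
        (show T ≤ T + 1 by linarith) (mem_univ T)
      simp only [univ_inter] at hsplit
      rw [← hsplit]
      refine add_le_add ?_ ?_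
      · rw [eVariationOn.congr (g := fun t => WithLp.toLp p (γ t))]
        · exact hlen
        · intro t ht; simp only [e1 ht]
      · rw [eVariationOn.congr (g := fun t => WithLp.toLp p (σ t))]
        swap
        · intro t ht; simp only [e2 ht]
        have hlip : LipschitzOnWith (nndist (WithLp.toLp p (gridPt v)) (WithLp.toLp p (gridPt w)))
            (fun t => WithLp.toLp p (σ t)) univ := by
          have : (fun t => WithLp.toLp p (σ t)) = fun t =>
              AffineMap.lineMap (WithLp.toLp p (gridPt v)) (WithLp.toLp p (gridPt w)) (t - T) := by
            funext t
            simp [hσ, AffineMap.lineMap_apply]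
          rw [this, lipschitzOnWith_univ]
          refine LipschitzWith.of_dist_le_mul fun s t => ?_
          rw [dist_lineMap_lineMap, dist_sub_right, mul_comm]
          rfl
        have := hlip.comp_eVariationOn_le (g := id) (s := Icc T (T + 1)) (mapsTo_univ _ _)
        refine this.trans ?_
        rw [edist_nndist]
        have hid : eVariationOn (id : ℝ → ℝ) (Icc T (T + 1)) ≤ 1 := by
          have := (monotone_id.monotoneOn (Icc T (T + 1))).eVariationOn_eq
            (a := T) (b := T + 1) ⟨le_rfl, by linarith⟩ ⟨by linarith, le_rfl⟩
          simp_all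
        calc _ ≤ (nndist (WithLp.toLp p (gridPt v)) (WithLp.toLp p (gridPt w)) : ℝ≥0∞) * 1 := by
              gcongr
          _ = _ := mul_one _

/-- A closed walk gives a closed tour through the visited vertices, of the same length. -/
lemma GridWalk.exists_tour {C V : Finset (ℤ × ℤ)} {u : ℤ × ℤ} {p ℓ : ℝ≥0∞} [Fact (1 ≤ p)]
    (h : GridWalk C
      (fun v w => edist (WithLp.toLp p (gridPt v)) (WithLp.toLp p (gridPt w))) u u V ℓ) :
    ∃ γ : ℝ → ℝ × ℝ, IsClosedTour (region C) γ ∧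
      (∀ x ∈ V, ∃ t ∈ Icc (0 : ℝ) 1, γ t = gridPt x) ∧ tourLength p γ ≤ ℓ := by
  obtain ⟨T, γ, hT, hcont, h0, h1, hmem, hvis, hlen⟩ := h.exists_curve
  have hmaps : MapsTo (fun t => T * t) (Icc (0 : ℝ) 1) (Icc 0 T) := fun t ht =>
    ⟨mul_nonneg hT.le ht.1, mul_le_of_le_one_right hT.le ht.2⟩
  refine ⟨fun t => γ (T * t), ⟨?_, by simp [h0, h1], fun t ht => hmem _ (hmaps ht)⟩, ?_, ?_⟩
  · exact hcont.comp (by fun_prop) hmaps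
  · intro x hx
    obtain ⟨t, ht, htx⟩ := hvis x hx
    refine ⟨t / T, ⟨div_nonneg ht.1 hT.le, (div_le_one hT).2 ht.2⟩, ?_⟩
    simp only [mul_div_cancel₀ t hT.ne', htx]
  · refine le_trans ?_ hlen
    exact eVariationOn.comp_le_of_monotoneOn (fun t => WithLp.toLp p (γ t)) (φ := fun t => T * t)
      (fun a _ b _ hab => mul_le_mul_of_nonneg_left hab hT.le) hmaps

open MeasureTheory Topology Filter

/-! ### Random rounding to the grid -/

/-- The open unit square, the range of the offsets of the rounding. -/
def offsets : Set (ℝ × ℝ) := Ioo 0 1 ×ˢ Ioo 0 1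

/-- The point `p` rounded to a grid vertex with offset `o`: the coordinate `x` with integer part
`k` goes to `k` or `k + 1`, according to whether `x - k` is smaller than the offset. -/
noncomputable def roundPt (o p : ℝ × ℝ) : ℤ × ℤ := (⌊p.1 - o.1⌋ + 1, ⌊p.2 - o.2⌋ + 1)

lemma floor_add_one_eq_or {x : ℝ} {k : ℤ} (h1 : (k : ℝ) - 1 < x) (h2 : x < k + 1) :
    ⌊x⌋ + 1 = k ∨ ⌊x⌋ + 1 = k + 1 := by
  have h3 : k - 1 ≤ ⌊x⌋ := Int.le_floor.2 (by push_cast; exact h1.le)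
  have h4 : ⌊x⌋ < k + 1 := Int.floor_lt.2 (by push_cast; exact h2)
  omega

lemma isPixelCorner_roundPt {o p : ℝ × ℝ} {c : ℤ × ℤ} (ho : o ∈ offsets) (hp : p ∈ pixel c) :
    IsPixelCorner (roundPt o p) c := by
  obtain ⟨⟨_, _⟩, ⟨_, _⟩⟩ := ho
  obtain ⟨⟨_, _⟩, ⟨_, _⟩⟩ := mem_pixel.1 hp
  exact ⟨floor_add_one_eq_or (by linarith) (by linarith),
    floor_add_one_eq_or (by linarith) (by linarith)⟩

/-- If `p` has distance less than `1` from the point of a pixel given by the offset, then `p` is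
rounded to a corner of that pixel. -/
lemma isPixelCorner_roundPt_of_dist_lt {o p : ℝ × ℝ} {c : ℤ × ℤ}
    (h : dist p (gridPt c + o) < 1) : IsPixelCorner (roundPt o p) c := by
  rw [Prod.dist_eq, max_lt_iff, Real.dist_eq, Real.dist_eq, abs_lt, abs_lt] at h
  simp only [gridPt, Prod.fst_add, Prod.snd_add] at h
  obtain ⟨⟨_, _⟩, ⟨_, _⟩⟩ := h
  exact ⟨floor_add_one_eq_or (by linarith) (by linarith),
    floor_add_one_eq_or (by linarith) (by linarith)⟩

/-- The mean of `⌊x - a⌋` over `a ∈ [0, 1]` is `x` up to a constant, as the fractional part is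
periodic. -/
lemma integral_floor_sub : ∃ I : ℝ, ∀ x : ℝ, ∫ a in (0 : ℝ)..1, (⌊x - a⌋ : ℝ) = x - I := by
  have hint : ∀ a b : ℝ, IntervalIntegrable (fun t : ℝ => Int.fract t) volume a b := fun a b => by
    refine (intervalIntegrable_const (c := (1 : ℝ))).mono_fun
      measurable_fract.aestronglyMeasurable (Eventually.of_forall fun t => ?_)
    simp only [Real.norm_eq_abs, abs_of_nonneg (Int.fract_nonneg t), abs_one]
    exact (Int.fract_lt_one t).le
  refine ⟨1 / 2 + ∫ t in (0 : ℝ)..0 + 1, Int.fract t, fun x => ?_⟩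
  have hper : Function.Periodic (fun t : ℝ => Int.fract t) 1 := fun t => Int.fract_add_one t
  have e : ∀ t : ℝ, (⌊t⌋ : ℝ) = t - Int.fract t := fun t => by
    rw [eq_sub_iff_add_eq]; exact Int.floor_add_fract t
  rw [intervalIntegral.integral_comp_sub_left (fun t => (⌊t⌋ : ℝ)) x]
  simp_rw [e]
  rw [intervalIntegral.integral_sub (by simp) (hint _ _), integral_id,
    ← hper.intervalIntegral_add_eq (x - 1) 0]
  ring_nf

/-- On average over the offset, rounding does not expand distances on the line. -/
lemma lintegral_natAbs_floor_sub_le (x y : ℝ) :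
    ∫⁻ a in Ioo (0 : ℝ) 1, ((⌊x - a⌋ + 1 - (⌊y - a⌋ + 1)).natAbs : ℝ≥0∞) ≤ edist x y := by
  wlog hxy : y ≤ x generalizing x y
  · rw [edist_comm]
    refine (lintegral_congr fun a => ?_).trans_le (this y x (le_of_not_ge hxy))
    rw [← Int.natAbs_neg, neg_sub]
  obtain ⟨I, hI⟩ := integral_floor_sub
  have hint : ∀ x : ℝ, IntervalIntegrable (fun a : ℝ => (⌊x - a⌋ : ℝ)) volume 0 1 := fun x => by
    refine AntitoneOn.intervalIntegrable fun a _ b _ hab => ?_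
    exact_mod_cast Int.floor_le_floor (by linarith)
  have h1 : ∀ a : ℝ, ((⌊x - a⌋ + 1 - (⌊y - a⌋ + 1)).natAbs : ℝ≥0∞) =
      ENNReal.ofReal ((⌊x - a⌋ : ℝ) - ⌊y - a⌋) := fun a => by
    have h2 : ⌊y - a⌋ ≤ ⌊x - a⌋ := Int.floor_le_floor (by linarith)
    have h3 : ((⌊x - a⌋ : ℝ) - ⌊y - a⌋) = ((⌊x - a⌋ + 1 - (⌊y - a⌋ + 1)).natAbs : ℝ) := by
      rw [Nat.cast_natAbs, abs_of_nonneg (by omega)]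
      push_cast; ring
    rw [h3, ENNReal.ofReal_natCast]
  simp_rw [h1]
  rw [restrict_Ioo_eq_restrict_Ioc, ← ofReal_integral_eq_lintegral_ofReal,
    ← intervalIntegral.integral_of_le zero_le_one,
    intervalIntegral.integral_sub (hint x) (hint y), hI, hI, edist_dist, Real.dist_eq]
  · apply ENNReal.ofReal_le_ofReal
    rw [sub_sub_sub_cancel_right]
    exact le_abs_self _
  · exact (intervalIntegrable_iff_integrableOn_Ioc_of_le zero_le_one).1 ((hint x).sub (hint y))
  · refine Eventually.of_forall fun a => ?_
    have h2 : ⌊y - a⌋ ≤ ⌊x - a⌋ := Int.floor_le_floor (by linarith)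
    simpa using h2

lemma restrict_offsets : (volume : Measure (ℝ × ℝ)).restrict offsets =
    (volume.restrict (Ioo (0 : ℝ) 1)).prod (volume.restrict (Ioo (0 : ℝ) 1)) := by
  rw [Measure.prod_restrict, ← Measure.volume_eq_prod, offsets]

instance : IsProbabilityMeasure ((volume : Measure ℝ).restrict (Ioo (0 : ℝ) 1)) :=
  ⟨by simp⟩

instance : IsProbabilityMeasure ((volume : Measure (ℝ × ℝ)).restrict offsets) := by
  rw [restrict_offsets]; infer_instance

lemma measurable_gridDist_roundPt (p q : ℝ × ℝ) :
    Measurable fun o => gridDist (roundPt o p) (roundPt o q) := by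
  have h : ∀ f : ℝ × ℝ → ℤ, Measurable f → Measurable fun o => (f o).natAbs := fun f hf =>
    (measurable_from_top (f := Int.natAbs)).comp hf
  unfold gridDist roundPt
  refine (h _ ?_).add (h _ ?_) <;> fun_prop

/-- On average over the offset, rounding does not expand `L₁` distances. -/
lemma lintegral_gridDist_roundPt_le (p q : ℝ × ℝ) :
    ∫⁻ o in offsets, (gridDist (roundPt o p) (roundPt o q) : ℝ≥0∞) ≤
      edist (WithLp.toLp 1 p) (WithLp.toLp 1 q) := by
  have hm : ∀ x y : ℝ,
      Measurable fun a : ℝ => ((⌊x - a⌋ + 1 - (⌊y - a⌋ + 1)).natAbs : ℝ≥0∞) := fun x y => by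
    refine (measurable_from_top (f := fun k : ℤ => (k.natAbs : ℝ≥0∞))).comp ?_
    fun_prop
  simp only [gridDist, roundPt, Nat.cast_add]
  rw [restrict_offsets, WithLp.prod_edist_eq_of_L1]
  refine (lintegral_add_left
    (f := fun o : ℝ × ℝ => ((⌊p.1 - o.1⌋ + 1 - (⌊q.1 - o.1⌋ + 1)).natAbs : ℝ≥0∞))
    ((hm p.1 q.1).comp measurable_fst) _).trans_le (add_le_add ?_ ?_)
  · exact (measurePreserving_fst.lintegral_comp (hm p.1 q.1)).trans_le
      (lintegral_natAbs_floor_sub_le _ _)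
  · exact (measurePreserving_snd.lintegral_comp (hm p.2 q.2)).trans_le
      (lintegral_natAbs_floor_sub_le _ _)

/-- The curve `γ` between the times `s` and `t` can be rounded to a walk, for every offset, such
that the walk visits the rounded points `γ τ`, `τ ∈ F`, and has on average over the offset at most
the `L₁` length of the curve. -/
def HasRounding (C : Finset (ℤ × ℤ)) (γ : ℝ → ℝ × ℝ) (F : Set ℝ) (s t : ℝ) : Prop :=
  ∃ ℓ : ℝ × ℝ → ℕ, Measurable ℓ ∧
    ∫⁻ o in offsets, (ℓ o : ℝ≥0∞) ≤ eVariationOn (fun t => WithLp.toLp 1 (γ t)) (Icc s t) ∧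
    ∀ o ∈ offsets, ∃ V, GridWalk C gridDist (roundPt o (γ s)) (roundPt o (γ t)) V (ℓ o) ∧
      ∀ τ ∈ F, roundPt o (γ τ) ∈ V

namespace HasRounding

variable {C : Finset (ℤ × ℤ)} {γ : ℝ → ℝ × ℝ} {F F' : Set ℝ} {s t u : ℝ}

lemma of_mem_pixel {c : ℤ × ℤ} (hst : s ≤ t) (hc : c ∈ C) (hs : γ s ∈ pixel c)
    (ht : γ t ∈ pixel c) : HasRounding C γ {s, t} s t := by
  refine ⟨fun o => gridDist (roundPt o (γ s)) (roundPt o (γ t)),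
    measurable_gridDist_roundPt _ _, ?_, fun o ho => ?_⟩
  · exact (lintegral_gridDist_roundPt_le _ _).trans
      (eVariationOn.edist_le (fun t => WithLp.toLp 1 (γ t)) ⟨le_rfl, hst⟩ ⟨hst, le_rfl⟩)
  · have hs' := isPixelCorner_roundPt ho hs
    refine ⟨{roundPt o (γ t), roundPt o (γ s)}, ?_, ?_⟩
    · simpa using (GridWalk.single (d := gridDist) hc hs').step hc hs' (isPixelCorner_roundPt ho ht)
    · rintro τ (rfl | rfl) <;> simp

lemma trans (hst : s ≤ t) (htu : t ≤ u) (h : HasRounding C γ F s t) (h' : HasRounding C γ F' t u) :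
    HasRounding C γ (F ∪ F') s u := by
  obtain ⟨ℓ, hm, hle, hw⟩ := h
  obtain ⟨ℓ', hm', hle', hw'⟩ := h'
  refine ⟨fun o => ℓ o + ℓ' o, hm.add hm', ?_, fun o ho => ?_⟩
  · have hsplit := eVariationOn.Icc_add_Icc (fun t => WithLp.toLp 1 (γ t)) (s := univ) hst htu
      (mem_univ t)
    simp only [univ_inter] at hsplit
    rw [← hsplit]
    simp only [Nat.cast_add]
    rw [lintegral_add_left (by fun_prop)]
    exact add_le_add hle hle'
  · obtain ⟨V, hV, hF⟩ := hw o ho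
    obtain ⟨V', hV', hF'⟩ := hw' o ho
    refine ⟨_, hV.append hV', ?_⟩
    rintro τ (h | h)
    · exact Finset.mem_union_left _ (hF τ h)
    · exact Finset.mem_union_right _ (hF' τ h)

lemma mono (hF : F ⊆ F') (h : HasRounding C γ F' s t) : HasRounding C γ F s t := by
  obtain ⟨ℓ, hm, hle, hw⟩ := h
  refine ⟨ℓ, hm, hle, fun o ho => ?_⟩
  obtain ⟨V, hV, hV'⟩ := hw o ho
  exact ⟨V, hV, fun τ hτ => hV' τ (hF hτ)⟩

end HasRounding

/-- A transitive relation that holds locally on an interval holds between its end points. -/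
lemma rel_of_locally {R : ℝ → ℝ → Prop} {a b : ℝ} (hab : a ≤ b)
    (htrans : ∀ x y z, x ≤ y → y ≤ z → R x y → R y z → R x z)
    (hloc : ∀ t ∈ Icc a b, ∀ᶠ τ in 𝓝[Icc a b] t, (τ ≤ t → R τ t) ∧ (t ≤ τ → R t τ)) : R a b := by
  set A : Set ℝ := {t | ∀ τ ∈ Icc a t, R a τ} with hA
  have haa : R a a := ((hloc a ⟨le_rfl, hab⟩).self_of_nhdsWithin ⟨le_rfl, hab⟩).1 le_rfl
  suffices h : Icc a b ⊆ A from h ⟨hab, le_rfl⟩ b ⟨hab, le_rfl⟩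
  refine IsClosed.Icc_subset_of_forall_mem_nhdsWithin ?_ ?_ ?_
  · refine isClosed_of_closure_subset fun t ht => ?_
    have htI : t ∈ Icc a b := closure_minimal inter_subset_right isClosed_Icc ht
    refine ⟨fun τ hτ => ?_, htI⟩
    rcases hτ.2.lt_or_eq with hlt | rfl
    · obtain ⟨t', h1, h2⟩ := mem_closure_iff.1 ht _ isOpen_Ioi hlt
      exact h2.1 τ ⟨hτ.1, le_of_lt h1⟩
    · obtain ⟨U, hU, hτU, hUR⟩ := mem_nhdsWithin.1 (hloc τ htI)
      obtain ⟨t', h1, h2⟩ := mem_closure_iff.1 ht U hU hτU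
      rcases le_total t' τ with h | h
      · exact htrans _ _ _ h2.2.1 h (h2.1 t' ⟨h2.2.1, le_rfl⟩) ((hUR ⟨h1, h2.2⟩).1 h)
      · exact h2.1 τ ⟨hτ.1, h⟩
  · rintro τ ⟨h1, h2⟩
    rwa [le_antisymm h2 h1]
  · rintro x ⟨hxA, hx⟩
    obtain ⟨U, hU, hxU, hUR⟩ := mem_nhdsWithin.1 (hloc x ⟨hx.1, hx.2.le⟩)
    obtain ⟨ε, hε, hεU⟩ := Metric.isOpen_iff.1 hU x hxU
    filter_upwards [Ioo_mem_nhdsGT (lt_min hx.2 (show x < x + ε by linarith))] with y hy τ hτ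
    obtain ⟨hy1, hy2⟩ := lt_min_iff.1 hy.2
    rcases le_total τ x with h | h
    · exact hxA τ ⟨hτ.1, h⟩
    · refine htrans _ _ _ hx.1 h (hxA x ⟨hx.1, le_rfl⟩) ((hUR ⟨hεU ?_, ?_⟩).2 h)
      · rw [Metric.mem_ball, Real.dist_eq, abs_lt]
        constructor <;> linarith [hτ.2]
      · exact ⟨hτ.1, by linarith [hτ.2]⟩

lemma isClosed_pixel (c : ℤ × ℤ) : IsClosed (pixel c) := isClosed_Icc.prod isClosed_Icc

/-- Points of the region close to `q` lie in a common pixel with `q`. -/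
lemma eventually_common_pixel (C : Finset (ℤ × ℤ)) (q : ℝ × ℝ) :
    ∀ᶠ x in 𝓝 q, x ∈ region C → ∃ c ∈ C, x ∈ pixel c ∧ q ∈ pixel c := by
  have h : ∀ᶠ x in 𝓝 q, ∀ c ∈ C, q ∉ pixel c → x ∉ pixel c := by
    rw [Filter.eventually_all_finset]
    intro c _
    by_cases hq : q ∈ pixel c
    · simp [hq]
    · filter_upwards [(isClosed_pixel c).isOpen_compl.mem_nhds hq] with x hx _ using hx
  filter_upwards [h] with x hx hxC
  obtain ⟨c, hc, hxc⟩ := mem_region.1 hxC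
  refine ⟨c, hc, hxc, ?_⟩
  by_contra hq
  exact hx c hc hq hxc

/-- Between any two times, a closed tour can be rounded so that the rounded walk passes the rounded
positions at finitely many given times. Locally this holds as points of the tour at nearby times
lie in a common pixel. -/
lemma IsClosedTour.hasRounding {C : Finset (ℤ × ℤ)} {γ : ℝ → ℝ × ℝ}
    (hγ : IsClosedTour (region C) γ) (F : Finset ℝ) :
    ∀ s t, 0 ≤ s → s ≤ t → t ≤ 1 → HasRounding C γ (↑F ∩ Icc s t) s t := by
  induction F using Finset.induction_on with
  | empty =>
    intro s t hs hst ht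
    have hsub : Icc s t ⊆ Icc 0 1 := Icc_subset_Icc hs ht
    refine rel_of_locally (R := HasRounding C γ (↑(∅ : Finset ℝ) ∩ Icc s t)) hst
      (fun x y z hxy hyz h h' => (h.trans hxy hyz h').mono subset_union_left) fun r hr => ?_
    have hcont : ContinuousWithinAt γ (Icc s t) r := (hγ.continuousOn.mono hsub) r hr
    filter_upwards [hcont.eventually (eventually_common_pixel C (γ r)), self_mem_nhdsWithin]
      with τ h hτ
    obtain ⟨c, hc, h1, h2⟩ := h (hγ.mem τ (hsub hτ))
    exact ⟨fun hle => (HasRounding.of_mem_pixel hle hc h1 h2).mono (by simp),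
      fun hle => (HasRounding.of_mem_pixel hle hc h2 h1).mono (by simp)⟩
  | insert a F _ ih =>
    intro s t hs hst ht
    by_cases ha : a ∈ Icc s t
    · obtain ⟨c, hc, hac⟩ := mem_region.1 (hγ.mem a ⟨hs.trans ha.1, ha.2.trans ht⟩)
      have h1 := ih s a hs ha.1 (ha.2.trans ht)
      have h2 := ih a t (hs.trans ha.1) ha.2 ht
      have h3 := HasRounding.of_mem_pixel le_rfl hc hac hac
      refine ((h1.trans ha.1 le_rfl h3).trans ha.1 ha.2 h2).mono ?_
      rintro τ ⟨h, h'⟩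
      rcases Finset.mem_insert.1 h with rfl | h
      · simp
      · rcases le_total τ a with hτ | hτ
        · exact .inl (.inl ⟨h, h'.1, hτ⟩)
        · exact .inr ⟨h, hτ, h'.2⟩
    · refine (ih s t hs hst ht).mono ?_
      rintro τ ⟨h, h'⟩
      rcases Finset.mem_insert.1 h with rfl | h
      · exact absurd h' ha
      · exact ⟨h, h'⟩

/-! ### Covering points seen with distance less than one -/

/-- Spheres around a compact set are null: a point at distance `1` from `K` is not a density point
of the set of these points, as every small ball around it contains a ball of a quarter of its
radius all of whose points are closer to `K`. -/
lemma volume_infDist_eq_one {K : Set (ℝ × ℝ)} (hK : IsCompact K) (hne : K.Nonempty) :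
    volume {q : ℝ × ℝ | Metric.infDist q K = 1} = 0 := by
  set Z := {q : ℝ × ℝ | Metric.infDist q K = 1} with hZ
  have hZm : MeasurableSet Z :=
    (isClosed_eq (Metric.continuous_infDist_pt K) continuous_const).measurableSet
  rw [← Measure.restrict_eq_zero, ← ae_eq_bot, ← eventually_false_iff_eq_bot]
  filter_upwards [Besicovitch.ae_tendsto_measure_inter_div volume Z, ae_restrict_mem hZm]
    with q hq hqZ
  obtain ⟨p, hp, hpq⟩ := hK.exists_infDist_eq_dist hne q
  have hqp : dist q p = 1 := hpq.symm.trans hqZ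
  have hball : ∀ x r, volume (Metric.closedBall (x : ℝ × ℝ) r) =
      ENNReal.ofReal (2 * r) * ENNReal.ofReal (2 * r) := fun x r => by
    rw [← closedBall_prod_same, Measure.volume_eq_prod, Measure.prod_prod, Real.volume_closedBall,
      Real.volume_closedBall]
  have hbound : ∀ᶠ r in 𝓝[>] (0 : ℝ),
      volume (Z ∩ Metric.closedBall q r) / volume (Metric.closedBall q r) ≤ 15 / 16 := by
    filter_upwards [Ioo_mem_nhdsGT one_pos] with r hr
    -- The ball of radius `r / 4` around `x` lies in the ball around `q` and misses `Z`.
    set x : ℝ × ℝ := AffineMap.lineMap q p (r / 2) with hx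
    have hxq : dist x q = r / 2 := by
      rw [hx, dist_lineMap_left, hqp, Real.norm_eq_abs, abs_of_pos (by linarith [hr.1]), mul_one]
    have hxp : dist x p = 1 - r / 2 := by
      rw [hx, dist_lineMap_right, hqp, Real.norm_eq_abs, abs_of_pos (by linarith [hr.2]), mul_one]
    have hsub : Metric.closedBall x (r / 4) ⊆ Metric.closedBall q r :=
      Metric.closedBall_subset_closedBall' (by linarith [hr.1])
    have hdisj : Z ∩ Metric.closedBall q r ⊆
        Metric.closedBall q r \ Metric.closedBall x (r / 4) := by
      rintro y ⟨hyZ, hy⟩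
      refine ⟨hy, fun hyx => ?_⟩
      have h1 : Metric.infDist y K ≤ dist y p := Metric.infDist_le_dist_of_mem hp
      have h2 := dist_triangle y x p
      rw [Metric.mem_closedBall] at hyx
      have h3 : Metric.infDist y K = 1 := hyZ
      linarith [hr.1]
    refine ENNReal.div_le_of_le_mul ((measure_mono hdisj).trans ?_)
    rw [measure_sdiff hsub Metric.isClosed_closedBall.measurableSet.nullMeasurableSet
      (measure_closedBall_lt_top).ne, hball, hball, tsub_le_iff_right]
    have e15 : (15 / 16 : ℝ≥0∞) = ENNReal.ofReal (15 / 16) := by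
      rw [ENNReal.ofReal_div_of_pos (by norm_num)]; simp
    have hr0 := hr.1
    rw [e15, ← ENNReal.ofReal_mul (by positivity), ← ENNReal.ofReal_mul (by positivity),
      ← ENNReal.ofReal_mul (by positivity), ← ENNReal.ofReal_add (by positivity) (by positivity)]
    apply ENNReal.ofReal_le_ofReal
    nlinarith [sq_nonneg r]
  have h15 := le_of_tendsto hq hbound
  have : (15 / 16 : ℝ≥0∞) < 1 := by
    rw [ENNReal.div_lt_iff (by norm_num) (by norm_num)]; norm_num
  exact absurd h15 (not_le.2 this)

/-- If every point of the region has distance at most `1` from `K`, then for almost every offset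
the corresponding points of the pixels have distance less than `1` from `K`. -/
lemma ae_forall_exists_dist_lt {C : Finset (ℤ × ℤ)} {K : Set (ℝ × ℝ)} (hK : IsCompact K)
    (hne : K.Nonempty) (hnear : ∀ q ∈ region C, ∃ p ∈ K, dist p q ≤ 1) :
    ∀ᵐ o ∂(volume.restrict offsets), ∀ c ∈ C, ∃ p ∈ K, dist p (gridPt c + o) < 1 := by
  rw [Finset.eventually_all]
  intro c hc
  have hnull : ∀ᵐ o : ℝ × ℝ, Metric.infDist (gridPt c + o) K ≠ 1 := by
    have := (measurePreserving_add_left (volume : Measure (ℝ × ℝ))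
      (gridPt c)).quasiMeasurePreserving
    exact this.ae (p := fun q => Metric.infDist q K ≠ 1)
      (by simpa [ae_iff] using volume_infDist_eq_one hK hne)
  have hoff : MeasurableSet offsets := measurableSet_Ioo.prod measurableSet_Ioo
  filter_upwards [ae_restrict_of_ae hnull, ae_restrict_mem hoff] with o ho hoU
  obtain ⟨⟨_, _⟩, ⟨_, _⟩⟩ := hoU
  obtain ⟨p, hp, hpq⟩ := hnear (gridPt c + o) (mem_region.2 ⟨c, hc, mem_pixel.2
    ⟨⟨by simp [gridPt]; linarith, by simp [gridPt]; linarith⟩,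
      ⟨by simp [gridPt]; linarith, by simp [gridPt]; linarith⟩⟩⟩)
  obtain ⟨p', hp', h⟩ := hK.exists_infDist_eq_dist hne (gridPt c + o)
  refine ⟨p', hp', ?_⟩
  rw [dist_comm, ← h]
  refine lt_of_le_of_ne ?_ ho
  exact (Metric.infDist_le_dist_of_mem hp).trans (by rwa [dist_comm])

/-! ### Lower bounds -/

/-- A scan cover can be rounded to a set of grid vertices that hits all pixels. -/
lemma IsScanCover.exists_hitsAll {C : Finset (ℤ × ℤ)} (hC : C.Nonempty) {S : Finset (ℝ × ℝ)}
    (hS : IsScanCover (region C) S) :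
    ∃ V : Finset (ℤ × ℤ), HitsAll C V ∧ (∀ v ∈ V, ∃ c ∈ C, IsPixelCorner v c) ∧
      V.card ≤ S.card := by
  have hnear : ∀ q ∈ region C, ∃ p ∈ (S : Set (ℝ × ℝ)), dist p q ≤ 1 := fun q hq => by
    obtain ⟨p, hp, h⟩ := hS.covers q hq
    exact ⟨p, hp, h.2⟩
  have hne : (S : Set (ℝ × ℝ)).Nonempty := by
    obtain ⟨c, hc⟩ := hC
    obtain ⟨p, hp, _⟩ := hnear _ (mem_region.2 ⟨c, hc, (isPixelCorner_self c).gridPt_mem⟩)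
    exact ⟨p, hp⟩
  have hoff : MeasurableSet offsets := measurableSet_Ioo.prod measurableSet_Ioo
  obtain ⟨o, ho, hoU⟩ := ((ae_forall_exists_dist_lt S.finite_toSet.isCompact hne hnear).and
    (ae_restrict_mem hoff)).exists
  refine ⟨S.image (roundPt o), fun c hc => ?_, fun v hv => ?_, Finset.card_image_le⟩
  · obtain ⟨p, hp, h⟩ := ho c hc
    exact ⟨_, Finset.mem_image_of_mem _ hp, isPixelCorner_roundPt_of_dist_lt h⟩
  · obtain ⟨p, hp, rfl⟩ := Finset.mem_image.1 hv
    obtain ⟨c, hc, hpc⟩ := mem_region.1 (hS.subset p hp)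
    exact ⟨c, hc, isPixelCorner_roundPt hoU hpc⟩

/-- If every point of the region comes within distance `1` of a closed tour, then the `L₁` length
of the tour is at least that of a shortest closed grid walk that hits all pixels. -/
lemma IsClosedTour.le_tourLength_one {C : Finset (ℤ × ℤ)} {γ : ℝ → ℝ × ℝ} {n : ℕ}
    (hn : ∀ m u V, GridWalk C gridDist u u V m → HitsAll C V → n ≤ m)
    (hγ : IsClosedTour (region C) γ)
    (hnear : ∀ q ∈ region C, ∃ t ∈ Icc (0 : ℝ) 1, dist (γ t) q ≤ 1) :
    (n : ℝ≥0∞) ≤ tourLength 1 γ := by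
  have hoff : MeasurableSet offsets := measurableSet_Ioo.prod measurableSet_Ioo
  have hae := ae_forall_exists_dist_lt (C := C) (isCompact_Icc.image_of_continuousOn hγ.continuousOn)
    ((nonempty_Icc.2 zero_le_one).image γ) (fun q hq => by
      obtain ⟨t, ht, h⟩ := hnear q hq
      exact ⟨_, mem_image_of_mem _ ht, h⟩)
  -- By continuity, the tour only matters at a countable dense set of times.
  set u := TopologicalSpace.denseSeq (Icc (0 : ℝ) 1) with hu
  set E : ℕ → Set (ℝ × ℝ) := fun k =>
    {o | ∀ c ∈ C, ∃ i < k, dist (γ (u i)) (gridPt c + o) < 1} with hE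
  have hmono : Monotone E := fun k l hkl o ho c hc => by
    obtain ⟨i, hi, h⟩ := ho c hc
    exact ⟨i, hi.trans_le hkl, h⟩
  have hγc : Continuous fun t : Icc (0 : ℝ) 1 => γ t := hγ.continuousOn.domRestrict
  have hfull : (volume.restrict offsets) (⋃ k, E k) = 1 := by
    refine le_antisymm prob_le_one ?_
    rw [← measure_univ (μ := volume.restrict offsets)]
    refine measure_mono_ae ?_
    filter_upwards [hae] with o ho _
    have h1 : ∀ c ∈ C, ∃ i, dist (γ (u i)) (gridPt c + o) < 1 := fun c hc => by
      obtain ⟨_, ⟨t, ht, rfl⟩, h⟩ := ho c hc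
      exact (TopologicalSpace.denseRange_denseSeq (Icc (0 : ℝ) 1)).exists_mem_open
        (isOpen_lt (hγc.dist continuous_const) continuous_const) ⟨⟨t, ht⟩, h⟩
    choose! i hi using h1
    exact mem_iUnion.2 ⟨C.sup i + 1, fun c hc =>
      ⟨i c, Nat.lt_succ_of_le (Finset.le_sup hc), hi c hc⟩⟩
  have hbound : ∀ k, n * (volume.restrict offsets) (E k) ≤ tourLength 1 γ := by
    intro k
    obtain ⟨ℓ, hm, hle, hw⟩ := hγ.hasRounding ((Finset.range k).image fun i => (u i : ℝ)) 0 1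
      le_rfl zero_le_one le_rfl
    refine le_trans ?_ hle
    refine le_trans ?_ (mul_meas_ge_le_lintegral (f := fun o => (ℓ o : ℝ≥0∞)) (by fun_prop) n)
    refine mul_le_mul_right (measure_mono_ae ?_) _
    filter_upwards [ae_restrict_mem hoff] with o hoU ho
    obtain ⟨V, hV, hF⟩ := hw o hoU
    rw [← hγ.closed] at hV
    have : n ≤ ℓ o := hn _ _ _ hV fun c hc => by
      obtain ⟨i, hi, h⟩ := ho c hc
      refine ⟨_, hF (u i) ⟨?_, (u i).2⟩, isPixelCorner_roundPt_of_dist_lt h⟩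
      exact Finset.mem_coe.2 (Finset.mem_image_of_mem _ (Finset.mem_range.2 hi))
    exact_mod_cast this
  have hlim := ENNReal.Tendsto.const_mul (a := (n : ℝ≥0∞))
    (tendsto_measure_iUnion_atTop (μ := volume.restrict offsets) hmono) (.inr (by simp))
  rw [hfull, mul_one] at hlim
  exact le_of_tendsto' hlim hbound

/-! ### Upper bounds -/

lemma gridPt_injective : Function.Injective gridPt := by
  rintro ⟨a, b⟩ ⟨c, d⟩ h
  simpa [gridPt, Prod.ext_iff] using h

/-- A scan at a grid vertex sees the whole of each pixel that has the vertex as a corner. -/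
lemma isScanCover_image_gridPt {C V : Finset (ℤ × ℤ)} (hV : HitsAll C V)
    (hVC : ∀ v ∈ V, ∃ c ∈ C, IsPixelCorner v c) :
    IsScanCover (region C) (V.image gridPt) := by
  refine ⟨fun p hp => ?_, fun q hq => ?_⟩
  · obtain ⟨v, hv, rfl⟩ := Finset.mem_image.1 hp
    obtain ⟨c, hc, h⟩ := hVC v hv
    exact mem_region.2 ⟨c, hc, h.gridPt_mem⟩
  · obtain ⟨c, hc, hqc⟩ := mem_region.1 hq
    obtain ⟨v, hv, h⟩ := hV c hc
    refine ⟨_, Finset.mem_image_of_mem _ hv, ?_, ?_⟩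
    · exact ((convex_pixel c).segment_subset h.gridPt_mem hqc).trans
        fun x hx => mem_region.2 ⟨c, hc, hx⟩
    · obtain ⟨⟨_, _⟩, ⟨_, _⟩⟩ := mem_pixel.1 hqc
      obtain ⟨⟨_, _⟩, ⟨_, _⟩⟩ := mem_pixel.1 h.gridPt_mem
      rw [Prod.dist_eq, max_le_iff, Real.dist_eq, Real.dist_eq, abs_le, abs_le]
      constructor <;> constructor <;> linarith

/-- In a set `S₀` of vertices that hits all pixels, one may keep a subset `D` and replace each
other vertex by at most four vertices of `V`, one for each of its pixels. -/
lemma exists_hitsAll_subset_union {C V S₀ D : Finset (ℤ × ℤ)} (hV : HitsAll C V)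
    (hS₀ : HitsAll C S₀) (hD : D ⊆ S₀) :
    ∃ S ⊆ D ∪ V, HitsAll C S ∧ S.card ≤ D.card + 4 * (S₀.card - D.card) := by
  classical
  choose! f hf using hV
  let N : ℤ × ℤ → Finset (ℤ × ℤ) := fun s =>
    ({s, (s.1 - 1, s.2), (s.1, s.2 - 1), (s.1 - 1, s.2 - 1)} : Finset (ℤ × ℤ)) ∩ C
  have hN : ∀ s c, c ∈ C → IsPixelCorner s c → c ∈ N s := by
    rintro ⟨s1, s2⟩ ⟨c1, c2⟩ hc ⟨h1, h2⟩
    simp only [N, Finset.mem_inter, Finset.mem_insert, Finset.mem_singleton, Prod.mk.injEq]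
    simp only at h1 h2
    refine ⟨?_, hc⟩
    omega
  refine ⟨D ∪ (S₀ \ D).biUnion fun s => (N s).image f, ?_, ?_, ?_⟩
  · refine Finset.union_subset_union_right (Finset.biUnion_subset.2 fun s _ => ?_)
    refine Finset.image_subset_iff.2 fun c hc => (hf c (Finset.mem_inter.1 hc).2).1
  · intro c hc
    obtain ⟨s, hs, hsc⟩ := hS₀ c hc
    by_cases hsD : s ∈ D
    · exact ⟨s, Finset.mem_union_left _ hsD, hsc⟩
    · refine ⟨f c, Finset.mem_union_right _ (Finset.mem_biUnion.2 ⟨s, ?_, ?_⟩), (hf c hc).2⟩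
      · exact Finset.mem_sdiff.2 ⟨hs, hsD⟩
      · exact Finset.mem_image_of_mem _ (hN s c hc hsc)
  · refine (Finset.card_union_le _ _).trans (Nat.add_le_add_left ?_ _)
    rw [← Finset.card_sdiff_of_subset hD, mul_comm]
    refine Finset.card_biUnion_le_card_mul _ _ _ fun s _ => ?_
    exact Finset.card_image_le.trans ((Finset.card_le_card Finset.inter_subset_left).trans
      Finset.card_le_four)

/-- The combinatorial heart of the approximation: from a shortest closed grid walk that hits all
pixels, of length `n`, and a minimum set of vertices that hits all pixels, a closed walk and scan
positions on it. The constant `κ` bounds the cost of a step between two corners of a pixel. -/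
lemma exists_bicriteria_gridWalk {C V S₀ : Finset (ℤ × ℤ)} {u : ℤ × ℤ} {n : ℕ}
    (hC : C.Nonempty) (hW : GridWalk C gridDist u u V n) (hV : HitsAll C V)
    (hn : ∀ m u V, GridWalk C gridDist u u V m → HitsAll C V → n ≤ m)
    (hS₀ : HitsAll C S₀) (hS₀C : ∀ v ∈ S₀, ∃ c ∈ C, IsPixelCorner v c)
    {d : ℤ × ℤ → ℤ × ℤ → ℝ≥0∞} {κ : ℝ≥0∞} (hd : ∀ v w, d v w ≤ gridDist v w)
    (hκ : ∀ c v w, IsPixelCorner v c → IsPixelCorner w c → d v w ≤ κ) :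
    ∃ V' S ℓ, GridWalk C d u u V' ℓ ∧ S ⊆ V' ∧ HitsAll C S ∧
      2 * S.card ≤ 5 * S₀.card ∧ ℓ ≤ n * (1 + 8 / 15 * κ) := by
  obtain ⟨ℓ, hℓ, hWd⟩ := hW.exists_le hd
  have hcard := hW.card_le.2 rfl
  have hpos : 0 < S₀.card := by
    obtain ⟨c, hc⟩ := hC
    obtain ⟨v, hv, _⟩ := hS₀ c hc
    exact Finset.card_pos.2 ⟨v, hv⟩
  by_cases hsmall : 2 * V.card ≤ 5 * S₀.card
  · refine ⟨V, V, ℓ, hWd, subset_rfl, hV, hsmall, hℓ.trans ?_⟩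
    exact le_mul_of_one_le_right (by simp) (by simp)
  -- A single vertex that hits all pixels would be a walk of length `0`.
  have h2 : 2 ≤ S₀.card := by
    by_contra! h1
    obtain ⟨s, hs⟩ := Finset.card_eq_one.1 (show S₀.card = 1 by omega)
    subst hs
    obtain ⟨c, hc, hsc⟩ := hS₀C s (Finset.mem_singleton_self s)
    have := hn 0 s {s} (.single hc hsc) hS₀
    omega
  -- Half of `S₀`, rounded up, is visited by detours; four vertices of `V` for each other element
  -- of `S₀` then make at most `5/2 |S₀|` scans.
  obtain ⟨D, hD, hDcard⟩ := Finset.exists_subset_card_eq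
    (show (S₀.card + 1) / 2 ≤ S₀.card by omega)
  obtain ⟨S, hS, hSC, hScard⟩ := exists_hitsAll_subset_union hV hS₀ hD
  obtain ⟨V', ℓ', hVV', hDV', hℓ', hW'⟩ := hWd.exists_detours hκ hV D
    fun s hs => hS₀C s (hD hs)
  refine ⟨V', S, ℓ', hW', hS.trans (Finset.union_subset hDV' hVV'), hSC, by omega, hℓ'.trans ?_⟩
  -- `|D| ≤ 2/3 |S₀|` as `2 ≤ |S₀|`, and `|S₀| < 2/5 n`.
  have hDn : 15 * D.card ≤ 4 * n := by omega
  have hDn' : (D.card : ℝ≥0∞) ≤ n * (4 / 15) := by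
    rw [← mul_div_assoc, ENNReal.le_div_iff_mul_le (by simp) (by simp), mul_comm,
      mul_comm (n : ℝ≥0∞)]
    exact_mod_cast hDn
  calc ℓ + D.card * (2 * κ) ≤ n + n * (4 / 15) * (2 * κ) := by gcongr
    _ = n * (1 + 4 / 15 * 2 * κ) := by ring
    _ = n * (1 + 8 / 15 * κ) := by
        congr 3
        rw [ENNReal.div_eq_inv_mul, ENNReal.div_eq_inv_mul, mul_assoc]
        norm_num

/-! ### Comparison of the metrics -/

lemma edist_gridPt_one (v w : ℤ × ℤ) :
    edist (WithLp.toLp 1 (gridPt v)) (WithLp.toLp 1 (gridPt w)) = gridDist v w := by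
  rw [WithLp.prod_edist_eq_of_L1, edist_dist, edist_dist, Real.dist_eq, Real.dist_eq,
    ← ENNReal.ofReal_add (abs_nonneg _) (abs_nonneg _), ← ENNReal.ofReal_natCast]
  congr 1
  simp [gridDist, gridPt, Nat.cast_natAbs]

lemma edist_gridPt_two_le (v w : ℤ × ℤ) :
    edist (WithLp.toLp 2 (gridPt v)) (WithLp.toLp 2 (gridPt w)) ≤ gridDist v w := by
  rw [← edist_gridPt_one, WithLp.prod_edist_eq_of_L1, edist_dist, edist_dist, edist_dist,
    ← ENNReal.ofReal_add dist_nonneg dist_nonneg, WithLp.prod_dist_eq_of_L2]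
  refine ENNReal.ofReal_le_ofReal (Real.sqrt_le_iff.2 ⟨by positivity, ?_⟩)
  have h1 : 0 ≤ dist (WithLp.toLp 2 (gridPt v)).fst (WithLp.toLp 2 (gridPt w)).fst := dist_nonneg
  have h2 : 0 ≤ dist (WithLp.toLp 2 (gridPt v)).snd (WithLp.toLp 2 (gridPt w)).snd := dist_nonneg
  change _ ≤ (dist (WithLp.toLp 2 (gridPt v)).fst (WithLp.toLp 2 (gridPt w)).fst +
    dist (WithLp.toLp 2 (gridPt v)).snd (WithLp.toLp 2 (gridPt w)).snd) ^ 2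
  nlinarith [mul_nonneg h1 h2]

lemma gridDist_le_two {c v w : ℤ × ℤ} (hv : IsPixelCorner v c) (hw : IsPixelCorner w c) :
    gridDist v w ≤ 2 := by
  simp only [IsPixelCorner, gridDist] at *
  omega

lemma edist_gridPt_two_le_sqrt {c v w : ℤ × ℤ} (hv : IsPixelCorner v c)
    (hw : IsPixelCorner w c) :
    edist (WithLp.toLp 2 (gridPt v)) (WithLp.toLp 2 (gridPt w)) ≤ ENNReal.ofReal √2 := by
  rw [edist_dist, WithLp.prod_dist_eq_of_L2]
  refine ENNReal.ofReal_le_ofReal (Real.sqrt_le_sqrt ?_)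
  obtain ⟨⟨_, _⟩, ⟨_, _⟩⟩ := mem_pixel.1 hv.gridPt_mem
  obtain ⟨⟨_, _⟩, ⟨_, _⟩⟩ := mem_pixel.1 hw.gridPt_mem
  simp only [Real.dist_eq, sq_abs]
  have h1 : ((gridPt v).1 - (gridPt w).1) ^ 2 ≤ 1 := by
    rw [sq_le_one_iff_abs_le_one, abs_le]; constructor <;> linarith
  have h2 : ((gridPt v).2 - (gridPt w).2) ^ 2 ≤ 1 := by
    rw [sq_le_one_iff_abs_le_one, abs_le]; constructor <;> linarith
  exact (add_le_add h1 h2).trans (by norm_num)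

/-- The `L₁` length of a tour is at most `√2` times its Euclidean length. -/
lemma tourLength_one_le (γ : ℝ → ℝ × ℝ) :
    tourLength 1 γ ≤ ENNReal.ofReal √2 * tourLength 2 γ := by
  have hlip : LipschitzOnWith (Real.toNNReal √2)
      (fun x : WithLp 2 (ℝ × ℝ) => WithLp.toLp 1 (WithLp.ofLp x)) univ := by
    rw [lipschitzOnWith_univ]
    refine LipschitzWith.of_dist_le_mul fun x y => ?_
    rw [WithLp.prod_dist_eq_of_L1, WithLp.prod_dist_eq_of_L2, Real.coe_toNNReal _ (by positivity),
      ← Real.sqrt_mul (by norm_num)]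
    refine Real.le_sqrt_of_sq_le ?_
    change (dist x.fst y.fst + dist x.snd y.snd) ^ 2 ≤ _
    nlinarith [sq_nonneg (dist x.fst y.fst - dist x.snd y.snd)]
  exact hlip.comp_eVariationOn_le (mapsTo_univ _ _)

/-- The constants for the two metrics: `κ` bounds the distance of two corners of a pixel, and `k`
the ratio of the `L₁` length to the `L_p` length. The last inequality is tight up to `0.02` in the
Euclidean case. -/
lemma tourLength_constants {p : ℝ≥0∞} [Fact (1 ≤ p)] (hp : p = 1 ∨ p = 2) :
    ∃ κ k : ℝ≥0∞,
      (∀ v w, edist (WithLp.toLp p (gridPt v)) (WithLp.toLp p (gridPt w)) ≤ gridDist v w) ∧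
      (∀ c v w, IsPixelCorner v c → IsPixelCorner w c →
        edist (WithLp.toLp p (gridPt v)) (WithLp.toLp p (gridPt w)) ≤ κ) ∧
      (∀ γ, tourLength 1 γ ≤ k * tourLength p γ) ∧ k * (1 + 8 / 15 * κ) ≤ 5 / 2 := by
  have e1 : (5 / 2 : ℝ≥0∞) = ENNReal.ofReal (5 / 2) := by
    rw [ENNReal.ofReal_div_of_pos (by norm_num)]; simp
  have e2 : (8 / 15 : ℝ≥0∞) = ENNReal.ofReal (8 / 15) := by
    rw [ENNReal.ofReal_div_of_pos (by norm_num)]; simp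
  have key : ∀ a b : ℝ, 0 ≤ a → 0 ≤ b → b * (1 + 8 / 15 * a) ≤ 5 / 2 →
      ENNReal.ofReal b * (1 + 8 / 15 * ENNReal.ofReal a) ≤ 5 / 2 := fun a b ha hb h => by
    rw [e1, e2, ← ENNReal.ofReal_mul (by norm_num), ← ENNReal.ofReal_one,
      ← ENNReal.ofReal_add (by norm_num) (by positivity), ← ENNReal.ofReal_mul hb]
    exact ENNReal.ofReal_le_ofReal h
  rcases hp with rfl | rfl
  · refine ⟨ENNReal.ofReal 2, ENNReal.ofReal 1, fun v w => (edist_gridPt_one v w).le,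
      fun c v w hv hw => ?_, fun γ => by simp [tourLength],
      key 2 1 (by norm_num) (by norm_num) (by norm_num)⟩
    rw [edist_gridPt_one]
    simpa using gridDist_le_two hv hw
  · refine ⟨ENNReal.ofReal √2, ENNReal.ofReal √2, edist_gridPt_two_le,
      fun c v w hv hw => edist_gridPt_two_le_sqrt hv hw, tourLength_one_le,
      key _ _ (by positivity) (by positivity) ?_⟩
    have h := Real.sq_sqrt (show (0 : ℝ) ≤ 2 by norm_num)
    -- The left-hand side is `√2 + 16/15`.
    have : √2 ≤ 1.42 := by
      rw [Real.sqrt_le_left (by norm_num)]; norm_num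
    nlinarith

theorem theorem2 (C : Finset (ℤ × ℤ)) (hC : IsPolyomino C)
    (p : ℝ≥0∞) [Fact (1 ≤ p)] (hp : p = 1 ∨ p = 2) :
    ∃ (γ : ℝ → ℝ × ℝ) (S : Finset (ℝ × ℝ)),
      IsMWPDVSolution (region C) γ S ∧
      (∀ S' : Finset (ℝ × ℝ), IsScanCover (region C) S' →
        (S.card : ℝ) ≤ 5 / 2 * (S'.card : ℝ)) ∧
      (∀ (γ' : ℝ → ℝ × ℝ) (S' : Finset (ℝ × ℝ)), IsMWPDVSolution (region C) γ' S' →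
        tourLength p γ ≤ 5 / 2 * tourLength p γ') ∧
      (∀ γ' : ℝ → ℝ × ℝ, IsMillingTour (region C) γ' →
        tourLength p γ ≤ 5 / 2 * tourLength p γ') := by
  classical
  have hex := hC.exists_closed_gridWalk
  obtain ⟨u, V, hW, hV⟩ := Nat.find_spec hex
  have hn : ∀ m u V, GridWalk C gridDist u u V m → HitsAll C V → Nat.find hex ≤ m :=
    fun m u V h h' => Nat.find_min' hex ⟨u, V, h, h'⟩
  set n := Nat.find hex
  have hexS : ∃ k, ∃ S₀ : Finset (ℤ × ℤ), HitsAll C S₀ ∧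
      (∀ v ∈ S₀, ∃ c ∈ C, IsPixelCorner v c) ∧ S₀.card = k :=
    ⟨_, V, hV, hW.exists_isPixelCorner, rfl⟩
  obtain ⟨S₀, hS₀, hS₀C, hk⟩ := Nat.find_spec hexS
  obtain ⟨κ, k, hd, hκ, hlen, hconst⟩ := tourLength_constants hp
  obtain ⟨V', S, ℓ, hW', hSV', hS, hcard, hℓ⟩ :=
    exists_bicriteria_gridWalk hC.nonempty hW hV hn hS₀ hS₀C hd hκ
  obtain ⟨γ, hγ, hvis, hγℓ⟩ := hW'.exists_tour
  have hbound : ∀ γ' : ℝ → ℝ × ℝ, IsClosedTour (region C) γ' →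
      (∀ q ∈ region C, ∃ t ∈ Icc (0 : ℝ) 1, dist (γ' t) q ≤ 1) →
      tourLength p γ ≤ 5 / 2 * tourLength p γ' := fun γ' hγ' hnear => by
    calc tourLength p γ ≤ n * (1 + 8 / 15 * κ) := hγℓ.trans hℓ
      _ ≤ k * tourLength p γ' * (1 + 8 / 15 * κ) := by
        gcongr
        exact (hγ'.le_tourLength_one hn hnear).trans (hlen γ')
      _ = k * (1 + 8 / 15 * κ) * tourLength p γ' := by ring
      _ ≤ 5 / 2 * tourLength p γ' := by gcongr
  refine ⟨γ, S.image gridPt, ⟨hγ, ?_, ?_⟩, ?_, ?_, ?_⟩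
  · intro q hq
    obtain ⟨v, hv, rfl⟩ := Finset.mem_image.1 hq
    exact hvis v (hSV' hv)
  · exact isScanCover_image_gridPt hS fun v hv => hW'.exists_isPixelCorner v (hSV' hv)
  · intro S' hS'
    obtain ⟨V₁, h1, h2, h3⟩ := hS'.exists_hitsAll hC.nonempty
    have h4 : S₀.card ≤ S'.card :=
      (hk.trans_le (Nat.find_min' hexS ⟨V₁, h1, h2, rfl⟩)).trans h3
    rw [Finset.card_image_of_injective _ gridPt_injective]
    have h5 : (2 * S.card : ℝ) ≤ 5 * S'.card := by exact_mod_cast (by omega)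
    linarith
  · intro γ' S' h
    refine hbound γ' h.tour fun q hq => ?_
    obtain ⟨s, hs, hsee⟩ := h.cover.covers q hq
    obtain ⟨t, ht, rfl⟩ := h.on_tour s hs
    exact ⟨t, ht, hsee.2⟩
  · intro γ' h
    refine hbound γ' h.tour fun q hq => ?_
    obtain ⟨t, ht, hqt⟩ := h.sweeps q hq
    exact ⟨t, ht, by rw [dist_comm]; exact hqt⟩
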